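/- Let $\widehat{\mathbb Z} = \varprojlim_m \mathbb Z/m\mathbb Z$ be the profinite completion of $\mathbb Z$, with its profinite topology. For a commutative ring $R$ and a positive integer $g$, let $\Omega_{2g} = \begin{pmatrix} 0 & \mathrm{id}_g \\ -\mathrm{id}_g & 0 \end{pmatrix}$, let $$\operatorname{GSp}_{2g}(R) = \{ S \in \operatorname{GL}_{2g}(R) : S^T \Omega_{2g} S = m\, \Omega_{2g} \text{ for some } m \in R^\times \},$$ and let $\operatorname{Sp}_{2g}(R) = \{ S \in \operatorname{GL}_{2g}(R) : S^T \Omega_{2g} S = \Omega_{2g} \}$. Give $\operatorname{GSp}_{2g}(\widehat{\mathbb Z})$ and $\operatorname{Sp}_{2g}(\widehat{\mathbb Z})$ the topologies induced from that of the topological group $\operatorname{GL}_{2g}(\widehat{\mathbb Z})$. **Proposition 2.7.** Let $g \geq 2$, and let $H \subset \operatorname{GSp}_{2g}(\widehat{\mathbb Z})$ be an open subgroup. Then the closure in $\operatorname{GSp}_{2g}(\widehat{\mathbb Z})$ of the commutator subgroup $[H,H]$ is contained in $\operatorname{Sp}_{2g}(\widehat{\mathbb Z})$ and is an open subgroup of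 $\operatorname{Sp}_{2g}(\widehat{\mathbb Z})$. -/

import Mathlib

namespace AdelicSymplectic

/-- The profinite completion of `ℤ`, as a subring of `∏_{n ≥ 1} ℤ/nℤ`: the inverse limit of the
rings `ℤ/nℤ`, consisting of the families compatible with all reduction maps `ℤ/nℤ → ℤ/mℤ` for
`m ∣ n`. -/
def profiniteIntegers : Subring (∀ n : ℕ+, ZMod (n : ℕ)) where
  carrier := {x | ∀ (m n : ℕ+) (h : (m : ℕ) ∣ (n : ℕ)), ZMod.castHom h (ZMod (m : ℕ)) (x n) = x m}
  mul_mem' := by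
    intro a b ha hb m n h
    simp only [Pi.mul_apply, map_mul, ha m n h, hb m n h]
  one_mem' := by
    intro m n h
    simp only [Pi.one_apply, map_one]
  add_mem' := by
    intro a b ha hb m n h
    simp only [Pi.add_apply, map_add, ha m n h, hb m n h]
  zero_mem' := by
    intro m n h
    simp only [Pi.zero_apply, map_zero]
  neg_mem' := by
    intro a ha m n h
    simp only [Pi.neg_apply, map_neg, ha m n h]

/-- The topological ring `Ẑ`, with the profinite topology: the topology induced from the product
of the discrete rings `ℤ/nℤ`. -/
abbrev ZHat : Type := profiniteIntegers

/-- The matrix `Ω` with `g × g` blocks `0, 1, -1, 0`, of size `2g`; its rows and columns are indexed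
by `Fin g ⊕ Fin g`. -/
def Omega (g : ℕ) (R : Type*) [CommRing R] : Matrix (Fin g ⊕ Fin g) (Fin g ⊕ Fin g) R :=
  Matrix.fromBlocks 0 1 (-1) 0

/-- The general symplectic group `GSp_{2g}(R)`: the invertible matrices `S` of size `2g` such that
`Sᵀ Ω S = m Ω` for some unit `m` of `R`. -/
def GSp (g : ℕ) (R : Type*) [CommRing R] :
    Subgroup (Matrix.GeneralLinearGroup (Fin g ⊕ Fin g) R) where
  carrier := {S | ∃ m : Rˣ, (S.val).transpose * Omega g R * S.val = (m : R) • Omega g R}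
  mul_mem' := by
    rintro a b ⟨m, hm⟩ ⟨n, hn⟩
    refine ⟨m * n, ?_⟩
    calc ((a * b).val).transpose * Omega g R * (a * b).val
        = (b.val).transpose * ((a.val).transpose * Omega g R * a.val) * b.val := by
          simp only [Units.val_mul, Matrix.transpose_mul, Matrix.mul_assoc]
      _ = ((m * n : Rˣ) : R) • Omega g R := by
          rw [hm, Matrix.mul_smul, Matrix.smul_mul, hn, smul_smul, Units.val_mul]
  one_mem' := ⟨1, by simp⟩
  inv_mem' := by
    rintro a ⟨m, hm⟩
    refine ⟨m⁻¹, ?_⟩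
    have h1 : a.val * (a⁻¹).val = 1 := Units.mul_inv a
    have h2 : ((a⁻¹).val).transpose * (a.val).transpose = 1 := by
      rw [← Matrix.transpose_mul, h1, Matrix.transpose_one]
    have h3 : Omega g R = ((m⁻¹ : Rˣ) : R) • ((a.val).transpose * Omega g R * a.val) := by
      rw [hm, smul_smul, Units.inv_mul, one_smul]
    calc ((a⁻¹).val).transpose * Omega g R * (a⁻¹).val
        = ((m⁻¹ : Rˣ) : R) • ((((a⁻¹).val).transpose * (a.val).transpose) * Omega g R *
            (a.val * (a⁻¹).val)) := by
          conv_lhs => rw [h3]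
          simp only [Matrix.mul_smul, Matrix.smul_mul, Matrix.mul_assoc]
      _ = ((m⁻¹ : Rˣ) : R) • Omega g R := by
          rw [h1, h2, Matrix.one_mul, Matrix.mul_one]

/-- The symplectic group `Sp_{2g}(R)`, as a subgroup of `GSp_{2g}(R)`: the matrices with
multiplier `1`, that is, with `Sᵀ Ω S = Ω`. -/
def Sp (g : ℕ) (R : Type*) [CommRing R] : Subgroup (GSp g R) where
  carrier := {S | (S.val.val).transpose * Omega g R * S.val.val = Omega g R}
  mul_mem' := by
    intro a b ha hb
    calc ((a * b).val.val).transpose * Omega g R * (a * b).val.val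
        = (b.val.val).transpose * ((a.val.val).transpose * Omega g R * a.val.val) * b.val.val := by
          simp only [Subgroup.coe_mul, Units.val_mul, Matrix.transpose_mul, Matrix.mul_assoc]
      _ = Omega g R := by rw [ha, hb]
  one_mem' := by simp
  inv_mem' := by
    intro a ha
    have h1 : a.val.val * (a⁻¹).val.val = 1 := Units.mul_inv a.val
    have h2 : ((a⁻¹).val.val).transpose * (a.val.val).transpose = 1 := by
      rw [← Matrix.transpose_mul, h1, Matrix.transpose_one]
    calc ((a⁻¹).val.val).transpose * Omega g R * (a⁻¹).val.val
        = (((a⁻¹).val.val).transpose * (a.val.val).transpose) * Omega g R *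
            (a.val.val * (a⁻¹).val.val) := by
          conv_lhs => rw [← show (a.val.val).transpose * Omega g R * a.val.val = Omega g R from ha]
          simp only [Matrix.mul_assoc]
      _ = Omega g R := by rw [h1, h2, Matrix.one_mul, Matrix.mul_one]

/-- `Sp_{2g}(R)` consists of the elements of Mathlib's symplectic group. -/
theorem mem_Sp_iff {g : ℕ} {R : Type*} [CommRing R] (S : GSp g R) :
    S ∈ Sp g R ↔ S.val.val ∈ Matrix.symplecticGroup (Fin g) R := by
  have hJ : Omega g R = -Matrix.J (Fin g) R := by
    simp [Omega, Matrix.J, Matrix.fromBlocks_neg]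
  rw [SymplecticGroup.mem_iff']
  change (S.val.val).transpose * Omega g R * S.val.val = Omega g R ↔ _
  rw [hJ, Matrix.mul_neg, Matrix.neg_mul, neg_inj]

end AdelicSymplectic

/-! Containment holds because multipliers commute and `Sp` is closed. For openness, an open `H`
contains all of `GSp` congruent to 1 modulo some `N`, in particular the matrices `upper B`, `lower
B` and the block diagonal transvections of level `N`. Commutators of these produce every symmetric
`upper B` and `lower B` of level `2N²` (`elementary_le_commutator`); here `g ≥ 2` supplies an
off-diagonal transvection.

It remains to show that `elementary g m` is dense in the symplectic congruence subgroup of level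
`m²` (`exists_elementary_mul`). The approximation improves one prime at a time, from level `n` to
level `n p` (`exists_elementary_mul_prime`). If `p ∣ n`, then `n² = 0` in `ℤ/np`, and the block
factorization `exists_lower_levi_upper` leaves an additive problem (`mem_elementary_of_sq_zero`). If
`p ∤ n`, the group over `𝔽_p` is generated by symmetric unipotents (`mem_elementary_of_field`), and
these lift to matrices congruent to 1 modulo `n`. -/

namespace AdelicSymplectic

open Matrix

/-! ### Block unipotent and block diagonal matrices -/

section Blocks

variable {g : ℕ} {R S : Type*} [CommRing R] [CommRing S]

/-- The block matrix `1, B, 0, 1`, as an invertible matrix. -/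
def upper (B : Matrix (Fin g) (Fin g) R) : GL (Fin g ⊕ Fin g) R where
  val := fromBlocks 1 B 0 1
  inv := fromBlocks 1 (-B) 0 1
  val_inv := by simp [fromBlocks_multiply]
  inv_val := by simp [fromBlocks_multiply]

/-- The block matrix `1, 0, C, 1`, as an invertible matrix. -/
def lower (C : Matrix (Fin g) (Fin g) R) : GL (Fin g ⊕ Fin g) R where
  val := fromBlocks 1 0 C 1
  inv := fromBlocks 1 0 (-C) 1
  val_inv := by simp [fromBlocks_multiply]
  inv_val := by simp [fromBlocks_multiply]

/-- The homomorphism sending `P` to the block diagonal matrix with blocks `P` and `(P⁻¹)ᵀ`. -/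
def levi : GL (Fin g) R →* GL (Fin g ⊕ Fin g) R where
  toFun P :=
    { val := fromBlocks P.val 0 0 (P⁻¹).valᵀ
      inv := fromBlocks (P⁻¹).val 0 0 P.valᵀ
      val_inv := by
        simp only [fromBlocks_multiply, ← transpose_mul, Units.mul_inv]
        simp
      inv_val := by
        simp only [fromBlocks_multiply, ← transpose_mul, Units.inv_mul]
        simp }
  map_one' := by ext1; simp
  map_mul' P Q := by
    ext1
    simp only [Units.val_mul, fromBlocks_multiply, _root_.mul_inv_rev, transpose_mul]
    simp

theorem val_upper (B : Matrix (Fin g) (Fin g) R) : (upper B).val = fromBlocks 1 B 0 1 := rfl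

theorem val_lower (C : Matrix (Fin g) (Fin g) R) : (lower C).val = fromBlocks 1 0 C 1 := rfl

theorem val_levi (P : GL (Fin g) R) : (levi P).val = fromBlocks P.val 0 0 (P⁻¹).valᵀ := rfl

theorem upper_zero : upper (0 : Matrix (Fin g) (Fin g) R) = 1 := by
  ext1; simp [val_upper]

theorem lower_zero : lower (0 : Matrix (Fin g) (Fin g) R) = 1 := by
  ext1; simp [val_lower]

theorem upper_add (B C : Matrix (Fin g) (Fin g) R) : upper (B + C) = upper B * upper C := by
  ext1; simp [val_upper, fromBlocks_multiply, add_comm]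

theorem lower_add (B C : Matrix (Fin g) (Fin g) R) : lower (B + C) = lower B * lower C := by
  ext1; simp [val_lower, fromBlocks_multiply]

theorem upper_neg (B : Matrix (Fin g) (Fin g) R) : upper (-B) = (upper B)⁻¹ := by
  rw [eq_inv_iff_mul_eq_one, ← upper_add, neg_add_cancel, upper_zero]

theorem lower_neg (B : Matrix (Fin g) (Fin g) R) : lower (-B) = (lower B)⁻¹ := by
  rw [eq_inv_iff_mul_eq_one, ← lower_add, neg_add_cancel, lower_zero]

theorem levi_mul_upper (P : GL (Fin g) R) (B : Matrix (Fin g) (Fin g) R) :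
    levi P * upper B = upper (P.val * B * P.valᵀ) * levi P := by
  have h : P.valᵀ * (P⁻¹).valᵀ = 1 := by rw [← transpose_mul, Units.inv_mul, transpose_one]
  ext1
  simp only [Units.val_mul, val_upper, val_levi, fromBlocks_multiply, Matrix.mul_assoc, h]
  simp

theorem levi_mul_lower (P : GL (Fin g) R) (C : Matrix (Fin g) (Fin g) R) :
    levi P * lower C = lower ((P⁻¹).valᵀ * C * (P⁻¹).val) * levi P := by
  ext1
  simp only [Units.val_mul, val_lower, val_levi, fromBlocks_multiply, Matrix.mul_assoc,
    Units.inv_mul]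
  simp

theorem map_upper (f : R →+* S) (B : Matrix (Fin g) (Fin g) R) :
    GeneralLinearGroup.map f (upper B) = upper (B.map f) := by
  ext1
  change (fromBlocks 1 B 0 1).map f = fromBlocks 1 (B.map f) 0 1
  simp [fromBlocks_map]

theorem map_lower (f : R →+* S) (C : Matrix (Fin g) (Fin g) R) :
    GeneralLinearGroup.map f (lower C) = lower (C.map f) := by
  ext1
  change (fromBlocks 1 0 C 1).map f = fromBlocks 1 0 (C.map f) 1
  simp [fromBlocks_map]

theorem map_levi (f : R →+* S) (P : GL (Fin g) R) :
    GeneralLinearGroup.map f (levi P) = levi (GeneralLinearGroup.map f P) := by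
  ext1
  change (fromBlocks P.val 0 0 (P⁻¹).valᵀ).map f =
    fromBlocks (P.val.map f) 0 0 ((P⁻¹).val.map f)ᵀ
  simp [fromBlocks_map, transpose_map]

end Blocks

/-! ### Symplectic relations in block form -/

section Symplectic

variable {g : ℕ} {R S : Type*} [CommRing R] [CommRing S]

theorem mem_map_Sp {A : GL (Fin g ⊕ Fin g) R} :
    A ∈ (Sp g R).map (GSp g R).subtype ↔ A.valᵀ * Omega g R * A.val = Omega g R := by
  constructor
  · rintro ⟨B, hB, rfl⟩
    exact hB
  · intro h
    exact ⟨⟨A, 1, by simpa using h⟩, h, rfl⟩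

theorem map_mem_map_Sp (f : R →+* S) {A : GL (Fin g ⊕ Fin g) R}
    (hA : A ∈ (Sp g R).map (GSp g R).subtype) :
    GeneralLinearGroup.map f A ∈ (Sp g S).map (GSp g S).subtype := by
  rw [mem_map_Sp] at hA ⊢
  have hO : (Omega g R).map f = Omega g S := by
    simp [Omega, fromBlocks_map, Matrix.map_neg]
  change (A.val.map f)ᵀ * Omega g S * A.val.map f = Omega g S
  rw [← hO, ← transpose_map, ← Matrix.map_mul, ← Matrix.map_mul, hA]

theorem upper_mem_map_Sp {B : Matrix (Fin g) (Fin g) R} (hB : B.IsSymm) :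
    upper B ∈ (Sp g R).map (GSp g R).subtype := by
  rw [mem_map_Sp, val_upper, Omega]
  simp [fromBlocks_transpose, fromBlocks_multiply, hB.eq]

theorem lower_mem_map_Sp {C : Matrix (Fin g) (Fin g) R} (hC : C.IsSymm) :
    lower C ∈ (Sp g R).map (GSp g R).subtype := by
  rw [mem_map_Sp, val_lower, Omega]
  simp [fromBlocks_transpose, fromBlocks_multiply, hC.eq]

theorem symplectic_blocks {a b c d : Matrix (Fin g) (Fin g) R} :
    (fromBlocks a b c d)ᵀ * Omega g R * fromBlocks a b c d = Omega g R ↔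
      aᵀ * c = cᵀ * a ∧ aᵀ * d - cᵀ * b = 1 ∧ bᵀ * d = dᵀ * b ∧ dᵀ * a - bᵀ * c = 1 := by
  rw [Omega]
  simp only [fromBlocks_transpose, fromBlocks_multiply, Matrix.mul_zero, Matrix.mul_one,
    Matrix.mul_neg, zero_add, add_zero, Matrix.neg_mul, fromBlocks_inj]
  constructor
  · rintro ⟨h1, h2, h3, h4⟩
    refine ⟨?_, ?_, ?_, ?_⟩
    · rw [← sub_eq_zero, ← h1]; abel
    · rw [← h2]; abel
    · rw [← sub_eq_zero, ← h4]; abel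
    · rw [← neg_inj, ← h3]; abel
  · rintro ⟨h1, h2, h3, h4⟩
    refine ⟨?_, ?_, ?_, ?_⟩
    · rw [h1]; abel
    · rw [← h2]; abel
    · rw [← h4]; abel
    · rw [h3]; abel

theorem levi_mem_map_Sp (P : GL (Fin g) R) : levi P ∈ (Sp g R).map (GSp g R).subtype := by
  rw [mem_map_Sp, val_levi, symplectic_blocks]
  refine ⟨by simp, ?_, by simp, ?_⟩
  · rw [← transpose_mul, Units.inv_mul, transpose_one, transpose_zero, Matrix.zero_mul, sub_zero]
  · rw [transpose_transpose, Units.inv_mul, transpose_zero, Matrix.zero_mul, sub_zero]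

/-- A symplectic matrix with invertible upper left block is the product of a lower triangular, a
block diagonal and an upper triangular symplectic matrix. -/
theorem exists_lower_levi_upper {A : GL (Fin g ⊕ Fin g) R}
    (hA : A ∈ (Sp g R).map (GSp g R).subtype) {a b c d : Matrix (Fin g) (Fin g) R}
    (h : A.val = fromBlocks a b c d) (P : GL (Fin g) R) (hP : P.val = a) :
    (c * (P⁻¹).val).IsSymm ∧ ((P⁻¹).val * b).IsSymm ∧
      A = lower (c * (P⁻¹).val) * levi P * upper ((P⁻¹).val * b) := by
  rw [mem_map_Sp, h, symplectic_blocks] at hA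
  obtain ⟨h1, h2, h3, -⟩ := hA
  subst hP
  have e1 : P.val * (P⁻¹).val = 1 := Units.mul_inv P
  have e2 : (P⁻¹).val * P.val = 1 := Units.inv_mul P
  have e3 : (P⁻¹).valᵀ * P.valᵀ = 1 := by rw [← transpose_mul, e1, transpose_one]
  have hc : (c * (P⁻¹).val).IsSymm := by
    rw [Matrix.IsSymm, transpose_mul]
    calc (P⁻¹).valᵀ * cᵀ = (P⁻¹).valᵀ * (cᵀ * P.val) * (P⁻¹).val := by
          simp only [Matrix.mul_assoc, e1, Matrix.mul_one]
      _ = ((P⁻¹).valᵀ * P.valᵀ) * (c * (P⁻¹).val) := by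
          rw [← h1]; simp only [Matrix.mul_assoc]
      _ = _ := by rw [e3, Matrix.one_mul]
  -- The lower right block is forced by the other three.
  have hd : d = (P⁻¹).valᵀ + c * (P⁻¹).val * b := by
    have : P.valᵀ * d = 1 + cᵀ * b := by rw [← h2]; abel
    calc d = ((P⁻¹).valᵀ * P.valᵀ) * d := by rw [e3, Matrix.one_mul]
      _ = (P⁻¹).valᵀ + (c * (P⁻¹).val)ᵀ * b := by
          rw [Matrix.mul_assoc, this, Matrix.mul_add, Matrix.mul_one, transpose_mul,
            Matrix.mul_assoc]
      _ = _ := by rw [hc.eq]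
  refine ⟨hc, ?_, ?_⟩
  -- Substituting `d`, the quadratic terms `bᵀ c P⁻¹ b` cancel and exactly the symmetry of `P⁻¹ b`
  -- is left.
  · have h4 : bᵀ * d - dᵀ * b = 0 := sub_eq_zero.2 h3
    rw [hd, transpose_add, transpose_mul, hc.eq, transpose_transpose, Matrix.mul_add,
      Matrix.add_mul, Matrix.mul_assoc bᵀ, Matrix.mul_assoc c] at h4
    rw [Matrix.IsSymm, transpose_mul, ← sub_eq_zero, ← h4]
    abel
  · ext1
    rw [h, Units.val_mul, Units.val_mul, val_lower, val_levi, val_upper]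
    simp only [fromBlocks_multiply, Matrix.one_mul, Matrix.zero_mul, Matrix.mul_zero, add_zero,
      zero_add, Matrix.mul_one, ← Matrix.mul_assoc, e1]
    rw [Matrix.mul_assoc c, e2, Matrix.mul_one, hd, add_comm]

end Symplectic

/-! ### Elementary subgroups and their levels -/

section Elementary

variable {g : ℕ} {R S : Type*} [CommRing R] [CommRing S]

/-- The subgroup generated by the matrices `upper B` and `lower B`, where `B` is symmetric with
entries divisible by `m`. -/
def elementary (g : ℕ) {R : Type*} [CommRing R] (m : R) : Subgroup (GL (Fin g ⊕ Fin g) R) :=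
  Subgroup.closure {A | ∃ B : Matrix (Fin g) (Fin g) R, B.IsSymm ∧ (∀ i j, m ∣ B i j) ∧
    (A = upper B ∨ A = lower B)}

theorem upper_mem_elementary {m : R} {B : Matrix (Fin g) (Fin g) R} (hB : B.IsSymm)
    (h : ∀ i j, m ∣ B i j) : upper B ∈ elementary g m :=
  Subgroup.subset_closure ⟨B, hB, h, Or.inl rfl⟩

theorem lower_mem_elementary {m : R} {B : Matrix (Fin g) (Fin g) R} (hB : B.IsSymm)
    (h : ∀ i j, m ∣ B i j) : lower B ∈ elementary g m :=
  Subgroup.subset_closure ⟨B, hB, h, Or.inr rfl⟩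

theorem elementary_le {m : R} {K : Subgroup (GL (Fin g ⊕ Fin g) R)}
    (hu : ∀ B : Matrix (Fin g) (Fin g) R, B.IsSymm → (∀ i j, m ∣ B i j) → upper B ∈ K)
    (hl : ∀ B : Matrix (Fin g) (Fin g) R, B.IsSymm → (∀ i j, m ∣ B i j) → lower B ∈ K) :
    elementary g m ≤ K := by
  refine (Subgroup.closure_le _).2 ?_
  rintro _ ⟨B, hB, h, rfl | rfl⟩
  exacts [hu B hB h, hl B hB h]

theorem elementary_mono {m n : R} (h : m ∣ n) : elementary g n ≤ elementary g m :=
  elementary_le (fun _ hB h' => upper_mem_elementary hB fun i j => h.trans (h' i j))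
    (fun _ hB h' => lower_mem_elementary hB fun i j => h.trans (h' i j))

theorem elementary_le_map_Sp (m : R) : elementary g m ≤ (Sp g R).map (GSp g R).subtype :=
  elementary_le (fun _ hB _ => upper_mem_map_Sp hB) (fun _ hB _ => lower_mem_map_Sp hB)

theorem elementary_le_ker {m : R} (f : R →+* S) (hf : f m = 0) :
    elementary g m ≤ (GeneralLinearGroup.map (n := Fin g ⊕ Fin g) f).ker := by
  have key : ∀ B : Matrix (Fin g) (Fin g) R, (∀ i j, m ∣ B i j) → B.map f = 0 := by
    intro B hB
    ext i j
    have := map_dvd f (hB i j)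
    rw [hf, zero_dvd_iff] at this
    simpa using this
  refine elementary_le (fun B _ h => ?_) (fun B _ h => ?_)
  · rw [MonoidHom.mem_ker, map_upper, key B h, upper_zero]
  · rw [MonoidHom.mem_ker, map_lower, key B h, lower_zero]

theorem elementary_le_map {m : R} {n : S} (f : R →+* S) (hf : Function.Surjective f)
    (h : f m ∣ n) : elementary g n ≤ (elementary g m).map (GeneralLinearGroup.map f) := by
  -- Choosing the lift as a function of the entry alone keeps lifted matrices symmetric. The value 0
  -- off the multiples of `n` is never used.
  have key : ∀ y : S, ∃ x : R, n ∣ y → m ∣ x ∧ f x = y := by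
    intro y
    by_cases hy : n ∣ y
    · obtain ⟨z, rfl⟩ := h.trans hy
      obtain ⟨w, rfl⟩ := hf z
      exact ⟨m * w, fun _ => ⟨dvd_mul_right _ _, map_mul f m w⟩⟩
    · exact ⟨0, fun h => absurd h hy⟩
  choose s hs using key
  have hmap : ∀ B : Matrix (Fin g) (Fin g) S, (∀ i j, n ∣ B i j) → (B.map s).map f = B := by
    intro B hB
    ext i j
    exact (hs _ (hB i j)).2
  have hsymm : ∀ B : Matrix (Fin g) (Fin g) S, B.IsSymm → (B.map s).IsSymm := by
    intro B hB
    rw [Matrix.IsSymm, ← transpose_map, hB.eq]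
  refine elementary_le (fun B hB h' => ?_) (fun B hB h' => ?_)
  · exact ⟨upper (B.map s), upper_mem_elementary (hsymm B hB) fun i j => (hs _ (h' i j)).1,
      by rw [map_upper, hmap B h']⟩
  · exact ⟨lower (B.map s), lower_mem_elementary (hsymm B hB) fun i j => (hs _ (h' i j)).1,
      by rw [map_lower, hmap B h']⟩

theorem dvd_mul_apply_left {m : R} {A B : Matrix (Fin g) (Fin g) R} (h : ∀ i j, m ∣ A i j)
    (i j : Fin g) : m ∣ (A * B) i j := by
  rw [mul_apply]
  exact Finset.dvd_sum fun k _ => (h i k).mul_right _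

theorem dvd_mul_apply_right {m : R} {A B : Matrix (Fin g) (Fin g) R} (h : ∀ i j, m ∣ B i j)
    (i j : Fin g) : m ∣ (A * B) i j := by
  rw [mul_apply]
  exact Finset.dvd_sum fun k _ => (h k j).mul_left _

/-- The product `upper B * lower C` has upper left block `1 + B C`. In its block factorization the
outer factors still have level `m`, so the middle one can be solved for. -/
theorem levi_mem_elementary {m : R} {B C : Matrix (Fin g) (Fin g) R} (hB : B.IsSymm)
    (hC : C.IsSymm) (hmB : ∀ i j, m ∣ B i j) (hmC : ∀ i j, m ∣ C i j) (P : GL (Fin g) R)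
    (hP : P.val = 1 + B * C) : levi P ∈ elementary g m := by
  have hA : upper B * lower C ∈ (Sp g R).map (GSp g R).subtype :=
    mul_mem (upper_mem_map_Sp hB) (lower_mem_map_Sp hC)
  have hval : (upper B * lower C).val = fromBlocks (1 + B * C) B C 1 := by
    simp [val_upper, val_lower, fromBlocks_multiply]
  obtain ⟨h1, h2, h3⟩ := exists_lower_levi_upper hA hval P hP
  have h4 : levi P = (lower (C * (P⁻¹).val))⁻¹ * (upper B * lower C) *
      (upper ((P⁻¹).val * B))⁻¹ := by
    rw [h3]; group
  rw [h4]
  exact mul_mem (mul_mem (inv_mem (lower_mem_elementary h1 (dvd_mul_apply_left hmC)))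
    (mul_mem (upper_mem_elementary hB hmB) (lower_mem_elementary hC hmC)))
    (inv_mem (upper_mem_elementary h2 (dvd_mul_apply_right hmB)))

theorem dvd_single_apply {m t : R} (h : m ∣ t) (i j k l : Fin g) : m ∣ single i j t k l := by
  rw [single_apply]
  split_ifs
  exacts [h, dvd_zero m]

theorem isSymm_single (i : Fin g) (t : R) : (single i i t).IsSymm := by
  rw [Matrix.IsSymm, transpose_single]

theorem isSymm_single_add_single (i j : Fin g) (t : R) :
    (single i j t + single j i t).IsSymm := by
  rw [Matrix.IsSymm, transpose_add, transpose_single, transpose_single, add_comm]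

/-- The matrix `m² t E_ij` is a product of two symmetric matrices of level `m`, namely `m E_ii` and
`m t (E_ij + E_ji)`, or `m t E_ii` if `i = j`. This is the source of the loss from `m` to `m²`. -/
theorem levi_mem_elementary_of_single {m : R} (i j : Fin g) (t : R) (P : GL (Fin g) R)
    (hP : P.val = 1 + single i j (m * m * t)) : levi P ∈ elementary g m := by
  by_cases hij : i = j
  · subst hij
    refine levi_mem_elementary (isSymm_single i m) (isSymm_single i (m * t))
      (dvd_single_apply dvd_rfl i i) (dvd_single_apply (dvd_mul_right m t) i i) P ?_
    rw [hP, single_mul_single_same, mul_assoc]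
  · refine levi_mem_elementary (isSymm_single i m) (isSymm_single_add_single i j (m * t))
      (dvd_single_apply dvd_rfl i i) (fun k l => ?_) P ?_
    · exact dvd_add (dvd_single_apply (dvd_mul_right m t) i j k l)
        (dvd_single_apply (dvd_mul_right m t) j i k l)
    · rw [hP, Matrix.mul_add, single_mul_single_same, single_mul_single_of_ne (h := hij), add_zero,
        mul_assoc]

end Elementary

/-! ### Congruence kernels of square zero -/

section SquareZero

variable {g : ℕ} {R : Type*} [CommRing R]

/-- Since `n² = 0`, the map `X ↦ 1 + n X` turns sums into products, which reduces everything to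
single matrix units. -/
theorem levi_mem_elementary_of_sq_zero {m n : R} (hmn : m * m ∣ n) (hn : n * n = 0)
    (X : Matrix (Fin g) (Fin g) R) :
    ∃ P : GL (Fin g) R, P.val = 1 + n • X ∧ levi P ∈ elementary g m := by
  have hmul : ∀ Y Z : Matrix (Fin g) (Fin g) R,
      (1 + n • Y) * (1 + n • Z) = 1 + n • (Y + Z) := by
    intro Y Z
    rw [Matrix.add_mul, Matrix.mul_add, Matrix.mul_add, smul_mul_smul_comm, hn, zero_smul,
      smul_add, Matrix.one_mul, Matrix.one_mul, Matrix.mul_one]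
    abel
  induction X using Matrix.induction_on' with
  | h_zero => exact ⟨1, by simp, by rw [map_one]; exact one_mem _⟩
  | h_add Y Z hY hZ =>
    obtain ⟨P, hP, hP'⟩ := hY
    obtain ⟨Q, hQ, hQ'⟩ := hZ
    exact ⟨P * Q, by rw [Units.val_mul, hP, hQ, hmul], by rw [map_mul]; exact mul_mem hP' hQ'⟩
  | h_std_basis i j x =>
    obtain ⟨k, rfl⟩ := hmn
    refine ⟨⟨1 + (m * m * k) • single i j x, 1 + (m * m * k) • (-single i j x), ?_, ?_⟩, rfl, ?_⟩
    · rw [hmul]; simp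
    · rw [hmul]; simp
    · refine levi_mem_elementary_of_single i j (k * x) _ ?_
      change 1 + (m * m * k) • single i j x = _
      rw [smul_single, smul_eq_mul, mul_assoc (m * m)]

/-- Symplectic matrices congruent to `1` modulo an element `n` of square zero and divisible by
`m²` are elementary of level `m`. -/
theorem mem_elementary_of_sq_zero {m n : R} (hmn : m * m ∣ n) (hn : n * n = 0)
    {A : GL (Fin g ⊕ Fin g) R} (hA : A ∈ (Sp g R).map (GSp g R).subtype)
    (h : ∀ i j, n ∣ (A.val - 1) i j) : A ∈ elementary g m := by
  have hm : m ∣ n := (dvd_mul_right m m).trans hmn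
  choose X hX using h
  obtain ⟨P, hP, hP'⟩ := levi_mem_elementary_of_sq_zero hmn hn
    (Matrix.of fun i j => X (Sum.inl i) (Sum.inl j))
  obtain ⟨h1, h2, h3⟩ := exists_lower_levi_upper hA (fromBlocks_toBlocks A.val).symm P (by
    rw [hP]
    ext i j
    have := hX (Sum.inl i) (Sum.inl j)
    rw [Matrix.sub_apply, sub_eq_iff_eq_add'] at this
    simp [toBlocks₁₁, this, one_apply])
  rw [h3]
  refine mul_mem (mul_mem (lower_mem_elementary h1 (dvd_mul_apply_left fun i j => ?_)) hP')
    (upper_mem_elementary h2 (dvd_mul_apply_right fun i j => ?_))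
  · have := hX (Sum.inr i) (Sum.inl j)
    rw [Matrix.sub_apply, one_apply_ne (by simp), sub_zero] at this
    exact hm.trans ⟨_, this⟩
  · have := hX (Sum.inl i) (Sum.inr j)
    rw [Matrix.sub_apply, one_apply_ne (by simp), sub_zero] at this
    exact hm.trans ⟨_, this⟩

end SquareZero

/-! ### Generation over a field -/

section Field

variable {g : ℕ} {F : Type*} [Field F]

/-- Gaussian elimination reduces to transvections and to diagonal matrices `D = 1 + 1 · (D - 1)`,
both of the form `1 + B C` with symmetric factors. -/
theorem levi_mem_elementary_one (P : GL (Fin g) F) : levi P ∈ elementary g (1 : F) := by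
  suffices h : ∀ M : Matrix (Fin g) (Fin g) F, M.det ≠ 0 →
      ∃ Q : GL (Fin g) F, Q.val = M ∧ levi Q ∈ elementary g (1 : F) by
    obtain ⟨Q, hQ, hQ'⟩ := h P.val ((isUnit_iff_isUnit_det _).1 P.isUnit).ne_zero
    rwa [← Units.ext hQ]
  intro M hM
  refine diagonal_transvection_induction_of_det_ne_zero
    (fun M => ∃ Q : GL (Fin g) F, Q.val = M ∧ levi Q ∈ elementary g (1 : F)) M hM ?_ ?_ ?_
  · intro D hD
    refine ⟨GeneralLinearGroup.mkOfDetNeZero _ hD, rfl, ?_⟩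
    refine levi_mem_elementary (B := 1) (C := diagonal D - 1) isSymm_one
      ((isSymm_diagonal D).sub isSymm_one) (fun _ _ => one_dvd _) (fun _ _ => one_dvd _) _ ?_
    rw [Matrix.one_mul, add_sub_cancel]
    rfl
  · intro t
    refine ⟨GeneralLinearGroup.mkOfDetNeZero t.toMatrix (by simp), rfl, ?_⟩
    refine levi_mem_elementary_of_single t.i t.j t.c _ ?_
    rw [one_mul, one_mul]
    rfl
  · rintro A B - - ⟨P, rfl, hP⟩ ⟨Q, rfl, hQ⟩
    exact ⟨P * Q, rfl, by rw [map_mul]; exact mul_mem hP hQ⟩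

theorem isUnit_of_mulVec_injective {n : Type*} [Fintype n] [DecidableEq n] {A : Matrix n n F}
    (h : ∀ v, A *ᵥ v = 0 → v = 0) : IsUnit A := by
  rw [isUnit_iff_isUnit_det, isUnit_iff_ne_zero]
  intro h0
  obtain ⟨v, hv, hv'⟩ := exists_mulVec_eq_zero_iff.2 h0
  exact hv (h v hv')

/-- If `a` is diagonal, `aᵀ c` is symmetric and the kernels of `a` and `c` meet trivially, then
`a + b c` is invertible for some symmetric `b`. -/
theorem exists_isUnit_diagonal_add_mul {d : Fin g → F} {c : Matrix (Fin g) (Fin g) F}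
    (hs : ((diagonal d)ᵀ * c).IsSymm) (hk : ∀ v, diagonal d *ᵥ v = 0 → c *ᵥ v = 0 → v = 0) :
    ∃ b : Matrix (Fin g) (Fin g) F, b.IsSymm ∧ IsUnit (diagonal d + b * c) := by
  classical
  -- Take `b` to be the projection onto the coordinates where `d` vanishes: there row `i` of
  -- `(diagonal d + b c) v = 0` says `(c v) i = 0`, elsewhere it says `v i = 0`.
  refine ⟨diagonal fun i => if d i = 0 then 1 else 0, isSymm_diagonal _,
    isUnit_of_mulVec_injective fun v hv => ?_⟩
  have hrow : ∀ i, d i * v i + (if d i = 0 then 1 else 0) * (c *ᵥ v) i = 0 := by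
    intro i
    have := congrFun hv i
    rwa [add_mulVec, Pi.add_apply, mulVec_diagonal, ← mulVec_mulVec, mulVec_diagonal,
      Pi.zero_apply] at this
  have hv0 : ∀ i, d i * v i = 0 := by
    intro i
    by_cases hi : d i = 0
    · rw [hi, zero_mul]
    · simpa [hi] using hrow i
  refine hk v (funext fun i => by rw [mulVec_diagonal, hv0, Pi.zero_apply]) (funext fun i => ?_)
  by_cases hi : d i = 0
  · simpa [hi] using hrow i
  · rw [Pi.zero_apply, mulVec, dotProduct]
    refine Finset.sum_eq_zero fun j _ => ?_
    -- Symmetry reads `d i * c i j = d j * c j i`, so `c i j = 0` when `d i ≠ 0` and `d j = 0`.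
    by_cases hj : d j = 0
    · have := hs.apply i j
      rw [diagonal_transpose, diagonal_mul, diagonal_mul, hj, zero_mul] at this
      rw [(mul_eq_zero.1 this.symm).resolve_left hi, zero_mul]
    · rw [(mul_eq_zero.1 (hv0 j)).resolve_left hj, mul_zero]

/-- Row and column operations make `P a Q` diagonal. Replacing `c` by `P⁻ᵀ c Q` preserves both
hypotheses, and a solution `b` pulls back to `P⁻¹ b P⁻ᵀ`. -/
theorem exists_isUnit_add_mul {a c : Matrix (Fin g) (Fin g) F} (hs : (aᵀ * c).IsSymm)
    (hk : ∀ v, a *ᵥ v = 0 → c *ᵥ v = 0 → v = 0) :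
    ∃ b : Matrix (Fin g) (Fin g) F, b.IsSymm ∧ IsUnit (a + b * c) := by
  obtain ⟨L, L', d, hd⟩ := Pivot.exists_list_transvec_mul_mul_list_transvec_eq_diagonal a
  obtain ⟨P, hP⟩ : IsUnit (L.map TransvectionStruct.toMatrix).prod := by
    rw [isUnit_iff_isUnit_det, TransvectionStruct.det_toMatrix_prod]; exact isUnit_one
  obtain ⟨Q, hQ⟩ : IsUnit (L'.map TransvectionStruct.toMatrix).prod := by
    rw [isUnit_iff_isUnit_det, TransvectionStruct.det_toMatrix_prod]; exact isUnit_one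
  rw [← hP, ← hQ] at hd
  have hPt : P.valᵀ * (P⁻¹).valᵀ = 1 := by rw [← transpose_mul, Units.inv_mul, transpose_one]
  have hPl : (P⁻¹).val * P.val = 1 := Units.inv_mul P
  have hQr : Q.val * (Q⁻¹).val = 1 := Units.mul_inv Q
  obtain ⟨b, hb, hu⟩ := exists_isUnit_diagonal_add_mul (d := d) (c := (P⁻¹).valᵀ * c * Q.val)
    (by
      have : (diagonal d)ᵀ * ((P⁻¹).valᵀ * c * Q.val) = Q.valᵀ * (aᵀ * c) * Q.val := by
        rw [← hd]
        simp only [transpose_mul, Matrix.mul_assoc]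
        rw [← Matrix.mul_assoc P.valᵀ, hPt, Matrix.one_mul]
      rw [this, Matrix.IsSymm, transpose_mul, transpose_mul, hs.eq, transpose_transpose]
      simp only [Matrix.mul_assoc])
    (by
      intro v h1 h2
      have e1 : a *ᵥ (Q.val *ᵥ v) = 0 := by
        have : (P⁻¹).val *ᵥ (diagonal d *ᵥ v) = a *ᵥ (Q.val *ᵥ v) := by
          rw [← hd]
          simp only [mulVec_mulVec, Matrix.mul_assoc]
          rw [← Matrix.mul_assoc (P⁻¹).val, hPl, Matrix.one_mul]
        rw [← this, h1, mulVec_zero]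
      have e2 : c *ᵥ (Q.val *ᵥ v) = 0 := by
        have : P.valᵀ *ᵥ (((P⁻¹).valᵀ * c * Q.val) *ᵥ v) = c *ᵥ (Q.val *ᵥ v) := by
          simp only [mulVec_mulVec, Matrix.mul_assoc]
          rw [← Matrix.mul_assoc P.valᵀ, hPt, Matrix.one_mul]
        rw [← this, h2, mulVec_zero]
      have e3 := hk _ e1 e2
      have : (Q⁻¹).val *ᵥ (Q.val *ᵥ v) = v := by
        rw [mulVec_mulVec, Units.inv_mul, one_mulVec]
      rw [← this, e3, mulVec_zero])
  refine ⟨(P⁻¹).val * b * (P⁻¹).valᵀ, ?_, ?_⟩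
  · rw [Matrix.IsSymm, transpose_mul, transpose_mul, hb.eq, transpose_transpose,
      Matrix.mul_assoc]
  · have : a + (P⁻¹).val * b * (P⁻¹).valᵀ * c =
        (P⁻¹).val * (diagonal d + b * ((P⁻¹).valᵀ * c * Q.val)) * (Q⁻¹).val := by
      rw [← hd]
      simp only [Matrix.mul_add, Matrix.add_mul, Matrix.mul_assoc, hQr, Matrix.mul_one]
      rw [← Matrix.mul_assoc (P⁻¹).val P.val, hPl, Matrix.one_mul]
    rw [this]
    exact ((P⁻¹).isUnit.mul hu).mul (Q⁻¹).isUnit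

/-- Over a field, the symplectic group is generated by the matrices `upper B` and `lower B` with
`B` symmetric. -/
theorem mem_elementary_of_field {A : GL (Fin g ⊕ Fin g) F}
    (hA : A ∈ (Sp g F).map (GSp g F).subtype) : A ∈ elementary g (1 : F) := by
  obtain ⟨a, b, c, d, h⟩ : ∃ a b c d, A.val = fromBlocks a b c d :=
    ⟨_, _, _, _, (fromBlocks_toBlocks A.val).symm⟩
  have hA' := hA
  rw [mem_map_Sp, h, symplectic_blocks] at hA'
  -- Left multiplication by `upper B` changes the upper left block to `a + B c`. The kernels meet
  -- trivially because `A` is injective on vectors `(v, 0)`.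
  obtain ⟨B, hB, P, hP⟩ := exists_isUnit_add_mul (a := a) (c := c)
    (by rw [Matrix.IsSymm, transpose_mul, transpose_transpose, hA'.1])
    (by
      intro v h1 h2
      have e : A.val *ᵥ Sum.elim v 0 = 0 := by
        rw [h, fromBlocks_mulVec]
        simp [h1, h2]
      have e' : (A⁻¹).val *ᵥ (A.val *ᵥ Sum.elim v 0) = Sum.elim v 0 := by
        rw [mulVec_mulVec, Units.inv_mul, one_mulVec]
      rw [e, mulVec_zero] at e'
      funext i
      exact (congrFun e' (Sum.inl i)).symm)
  have hBe : upper B ∈ elementary g (1 : F) := upper_mem_elementary hB fun _ _ => one_dvd _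
  have hval : (upper B * A).val = fromBlocks (a + B * c) (b + B * d) c d := by
    rw [Units.val_mul, h, val_upper, fromBlocks_multiply]
    simp
  obtain ⟨h1, h2, h3⟩ := exists_lower_levi_upper (mul_mem (upper_mem_map_Sp hB) hA) hval P hP
  rw [← Subgroup.mul_mem_cancel_left _ hBe, h3]
  exact mul_mem (mul_mem (lower_mem_elementary h1 fun _ _ => one_dvd _)
    (levi_mem_elementary_one P)) (upper_mem_elementary h2 fun _ _ => one_dvd _)

end Field

/-! ### Unipotents obtained as commutators -/

section Commutator

variable {g : ℕ} {R : Type*} [CommRing R]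

theorem mem_of_isSymm {V : AddSubgroup (Matrix (Fin g) (Fin g) R)} {m : R}
    (hd : ∀ i x, m ∣ x → single i i x ∈ V)
    (ho : ∀ i j x, i ≠ j → m ∣ x → single i j x + single j i x ∈ V)
    {B : Matrix (Fin g) (Fin g) R} (hB : B.IsSymm) (hm : ∀ i j, m ∣ B i j) : B ∈ V := by
  -- The strictly upper triangular part: `B` is its diagonal plus `T + Tᵀ`.
  set T : Matrix (Fin g) (Fin g) R := Matrix.of fun i j => if i < j then B i j else 0 with hT
  have hdecomp : B = (∑ i, single i i (B i i)) + ∑ i, ∑ j, (single i j (T i j) +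
      single j i (T i j)) := by
    have h1 : ∑ i, single i i (B i i) = diagonal fun i => B i i := by
      ext k l
      simp only [Matrix.sum_apply, single_apply, diagonal_apply]
      by_cases hkl : k = l
      · subst hkl; simp
      · rw [if_neg hkl]
        refine Finset.sum_eq_zero fun i _ => if_neg ?_
        rintro ⟨rfl, rfl⟩
        exact hkl rfl
    have h2 : ∑ i, ∑ j, single j i (T i j) = Tᵀ := by
      rw [matrix_eq_sum_single Tᵀ, Finset.sum_comm]
      rfl
    simp only [Finset.sum_add_distrib]
    rw [h1, h2, ← matrix_eq_sum_single T]
    ext k l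
    simp only [Matrix.add_apply, transpose_apply, hT, of_apply, diagonal_apply]
    rcases lt_trichotomy k l with h | rfl | h
    · simp [h, h.ne, h.not_gt]
    · simp
    · simp [h, h.ne', h.not_gt, hB.apply k l]
  rw [hdecomp]
  refine add_mem (sum_mem fun i _ => hd i _ (hm i i)) (sum_mem fun i _ => sum_mem fun j _ => ?_)
  by_cases hij : i < j
  · refine ho i j _ hij.ne ?_
    simpa [hT, hij] using hm i j
  · have : T i j = 0 := by simp [hT, hij]
    rw [this, single_zero, single_zero, add_zero]
    exact zero_mem V

/-- With `u = 1 + N E_ij`, the difference `u B uᵀ - B` is `2N²t E_ii` for `B = N t (E_ij + E_ji)`,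
and `N s (E_ij + E_ji) + N² s E_ii` for `B = s E_jj`. -/
theorem mem_of_conj_sub_mem (hg : 2 ≤ g) {V : AddSubgroup (Matrix (Fin g) (Fin g) R)} {N : R}
    (h : ∀ (i j : Fin g) (B : Matrix (Fin g) (Fin g) R), i ≠ j → B.IsSymm →
      (∀ k l, N ∣ B k l) → (1 + single i j N) * B * (1 + single i j N)ᵀ - B ∈ V)
    {B : Matrix (Fin g) (Fin g) R} (hB : B.IsSymm) (hm : ∀ i j, 2 * (N * N) ∣ B i j) :
    B ∈ V := by
  have hd : ∀ (i : Fin g) (x : R), 2 * (N * N) ∣ x → single i i x ∈ V := by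
    rintro i _ ⟨t, rfl⟩
    have : Nontrivial (Fin g) := Fin.nontrivial_iff_two_le.2 hg
    obtain ⟨j, hij⟩ := exists_ne i
    have := h i j (single i j (N * t) + single j i (N * t)) hij.symm
      (isSymm_single_add_single i j _) (fun k l => dvd_add
        (dvd_single_apply (dvd_mul_right N t) i j k l)
        (dvd_single_apply (dvd_mul_right N t) j i k l))
    have hz : ∀ {k l : Fin g}, k ≠ l → ∀ (a b : Fin g) (x y : R),
        single a k x * single l b y = 0 := fun h a b x y => by
      rw [single_mul_single_of_ne (h := h)]
    convert this using 1
    rw [transpose_add, transpose_one, transpose_single]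
    simp only [Matrix.add_mul, Matrix.mul_add, Matrix.one_mul, Matrix.mul_one,
      single_mul_single_same, hz hij, hz hij.symm, add_zero]
    rw [show 2 * (N * N) * t = N * (N * t) + N * t * N by ring, single_add]
    abel
  refine mem_of_isSymm hd ?_ hB hm
  rintro i j _ hij ⟨t, rfl⟩
  -- The factor 2 makes the unwanted diagonal term `2N³t E_ii` one of those already obtained.
  have h1 := h i j (single j j (N * (2 * t))) hij (isSymm_single j _)
    (fun k l => dvd_single_apply (dvd_mul_right N _) j j k l)
  have h2 := hd i (N * (N * (2 * t)) * N) ⟨N * t, by ring⟩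
  convert sub_mem h1 h2 using 1
  rw [transpose_add, transpose_one, transpose_single]
  simp only [Matrix.add_mul, Matrix.mul_add, Matrix.one_mul, Matrix.mul_one,
    single_mul_single_same]
  rw [show 2 * (N * N) * t = N * (N * (2 * t)) by ring,
    show N * (2 * t) * N = N * (N * (2 * t)) by ring]
  abel

/-- The transvection `1 + t E_ij` as an invertible matrix. -/
def elementaryGL (i j : Fin g) (hij : i ≠ j) (t : R) : GL (Fin g) R where
  val := 1 + single i j t
  inv := 1 - single i j t
  val_inv := by
    rw [Matrix.add_mul, Matrix.mul_sub, Matrix.mul_sub, single_mul_single_of_ne (h := hij.symm)]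
    simp
  inv_val := by
    rw [Matrix.sub_mul, Matrix.mul_add, Matrix.mul_add, single_mul_single_of_ne (h := hij.symm)]
    simp

/-- The commutator of `levi P` and `upper B` is `upper (P B Pᵀ - B)`, and `upper` is additive, so
the `B` with `upper B ∈ ⁅K, K⁆` form an additive group containing these differences. -/
theorem elementary_le_commutator (hg : 2 ≤ g) {K : Subgroup (GL (Fin g ⊕ Fin g) R)} {N : R}
    (hK : elementary g N ≤ K)
    (hl : ∀ (i j : Fin g) (hij : i ≠ j), levi (elementaryGL i j hij N) ∈ K) :
    elementary g (2 * (N * N)) ≤ ⁅K, K⁆ := by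
  refine elementary_le (fun B hB hm => ?_) (fun B hB hm => ?_)
  · let V : AddSubgroup (Matrix (Fin g) (Fin g) R) :=
      { carrier := {B | upper B ∈ ⁅K, K⁆}
        zero_mem' := by
          change upper 0 ∈ ⁅K, K⁆
          rw [upper_zero]; exact one_mem _
        add_mem' := fun {a b} ha hb => by
          change upper (a + b) ∈ ⁅K, K⁆
          rw [upper_add]; exact mul_mem ha hb
        neg_mem' := fun {a} ha => by
          change upper (-a) ∈ ⁅K, K⁆
          rw [upper_neg]; exact inv_mem ha }
    refine mem_of_conj_sub_mem (V := V) hg (fun i j C hij hC hN => ?_) hB hm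
    change upper _ ∈ ⁅K, K⁆
    have := Subgroup.commutator_mem_commutator (hl i j hij)
      (hK (upper_mem_elementary hC hN))
    rwa [commutatorElement_def, levi_mul_upper, mul_inv_cancel_right, ← upper_neg, ← upper_add,
      ← sub_eq_add_neg] at this
  · let V : AddSubgroup (Matrix (Fin g) (Fin g) R) :=
      { carrier := {B | lower B ∈ ⁅K, K⁆}
        zero_mem' := by
          change lower 0 ∈ ⁅K, K⁆
          rw [lower_zero]; exact one_mem _
        add_mem' := fun {a b} ha hb => by
          change lower (a + b) ∈ ⁅K, K⁆
          rw [lower_add]; exact mul_mem ha hb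
        neg_mem' := fun {a} ha => by
          change lower (-a) ∈ ⁅K, K⁆
          rw [lower_neg]; exact inv_mem ha }
    refine mem_of_conj_sub_mem (V := V) hg (fun i j C hij hC hN => ?_) hB hm
    change lower _ ∈ ⁅K, K⁆
    -- On lower blocks `levi P` acts through `P⁻ᵀ`, so the inverse of the transposed transvection is
    -- needed.
    have := Subgroup.commutator_mem_commutator (inv_mem (hl j i hij.symm))
      (hK (lower_mem_elementary hC hN))
    rw [← map_inv, commutatorElement_def, levi_mul_lower, mul_inv_cancel_right, ← lower_neg,
      ← lower_add, ← sub_eq_add_neg, inv_inv] at this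
    have e : (elementaryGL j i hij.symm N).valᵀ = 1 + single i j N := by
      change (1 + single j i N)ᵀ = _
      rw [transpose_add, transpose_one, transpose_single]
    have e' : (elementaryGL j i hij.symm N).val = (1 + single i j N)ᵀ := by
      rw [← e, transpose_transpose]
    rwa [e, e'] at this

end Commutator

/-! ### Approximation over the profinite integers -/

section ZHat

variable {g : ℕ}

/-- The projection from `Ẑ` to `ℤ/nℤ`. -/
def proj (n : ℕ+) : ZHat →+* ZMod (n : ℕ) :=
  (Pi.evalRingHom (fun n : ℕ+ => ZMod (n : ℕ)) n).comp profiniteIntegers.subtype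

theorem proj_surjective (n : ℕ+) : Function.Surjective (proj n) := fun y => by
  obtain ⟨k, rfl⟩ := ZMod.intCast_surjective y
  exact ⟨k, map_intCast _ k⟩

theorem castHom_proj {m n : ℕ+} (h : (m : ℕ) ∣ (n : ℕ)) (x : ZHat) :
    ZMod.castHom h (ZMod (m : ℕ)) (proj n x) = proj m x := x.2 m n h

theorem proj_eq_zero_of_dvd {m n : ℕ+} (h : (m : ℕ) ∣ (n : ℕ)) {x : ZHat} (hx : proj n x = 0) :
    proj m x = 0 := by
  rw [← castHom_proj h, hx, map_zero]

theorem exists_int_proj_eq {m n : ℕ+} (h : (m : ℕ) ∣ (n : ℕ)) {x : ZHat} (hx : proj m x = 0) :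
    ∃ k : ℤ, proj n x = ((m * k : ℤ) : ZMod (n : ℕ)) := by
  obtain ⟨k, hk⟩ := ZMod.intCast_surjective (proj n x)
  rw [← castHom_proj h, ← hk, map_intCast, ZMod.intCast_zmod_eq_zero_iff_dvd] at hx
  obtain ⟨l, rfl⟩ := hx
  exact ⟨l, hk.symm⟩

theorem proj_mul_eq_zero {m n : ℕ+} (h : Nat.Coprime m n) {x : ZHat} (hm : proj m x = 0)
    (hn : proj n x = 0) : proj (m * n) x = 0 := by
  obtain ⟨k, hk⟩ := exists_int_proj_eq (n := m * n) ⟨n, PNat.mul_coe m n⟩ hm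
  rw [← castHom_proj (n := m * n) ⟨m, by rw [PNat.mul_coe, mul_comm]⟩, hk, map_intCast,
    ZMod.intCast_zmod_eq_zero_iff_dvd] at hn
  rw [hk, ZMod.intCast_zmod_eq_zero_iff_dvd, PNat.mul_coe, Nat.cast_mul]
  exact mul_dvd_mul_left _ ((Nat.isCoprime_iff_coprime.2 h.symm).dvd_of_dvd_mul_left hn)

/-- The principal congruence subgroup of level `n` of the general linear group over `Ẑ`. -/
def congruence (g : ℕ) (n : ℕ+) : Subgroup (GL (Fin g ⊕ Fin g) ZHat) :=
  (GeneralLinearGroup.map (proj n)).ker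

theorem mem_congruence {n : ℕ+} {A : GL (Fin g ⊕ Fin g) ZHat} :
    A ∈ congruence g n ↔ ∀ i j, proj n ((A.val - 1) i j) = 0 := by
  rw [congruence, MonoidHom.mem_ker, Units.ext_iff, ← Matrix.ext_iff]
  refine forall₂_congr fun i j => ?_
  change proj n (A.val i j) = (1 : Matrix _ _ _) i j ↔ _
  rw [Matrix.sub_apply, map_sub, sub_eq_zero, one_apply, one_apply, apply_ite (proj n), map_one,
    map_zero]

theorem congruence_le {m n : ℕ+} (h : (m : ℕ) ∣ (n : ℕ)) : congruence g n ≤ congruence g m :=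
  fun _ hA => mem_congruence.2 fun i j => proj_eq_zero_of_dvd h (mem_congruence.1 hA i j)

theorem elementary_le_congruence (n : ℕ+) :
    elementary g ((n : ℕ) : ZHat) ≤ congruence g n :=
  elementary_le_ker (proj n) (by rw [map_natCast, ZMod.natCast_self])

/-- If `p ∣ n`, the image of `A` modulo `n p` lies in a square-zero kernel. Otherwise it is enough
to correct `A` modulo `p` without disturbing it modulo `n`. -/
theorem exists_elementary_mul_prime {m n : ℕ+} (hmn : (m * m : ℕ) ∣ n) {p : ℕ+}
    (hp : (p : ℕ).Prime) {A : GL (Fin g ⊕ Fin g) ZHat}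
    (hA : A ∈ (Sp g ZHat).map (GSp g ZHat).subtype) (hn : A ∈ congruence g n) :
    ∃ E ∈ elementary g ((m : ℕ) : ZHat), E⁻¹ * A ∈ congruence g (n * p) := by
  by_cases hpn : (p : ℕ) ∣ n
  · have h1 : GeneralLinearGroup.map (proj (n * p)) A ∈
        elementary g ((m : ℕ) : ZMod ((n * p : ℕ+) : ℕ)) := by
      refine mem_elementary_of_sq_zero (n := ((n : ℕ) : ZMod ((n * p : ℕ+) : ℕ))) ?_ ?_
        (map_mem_map_Sp _ hA) fun i j => ?_
      · exact_mod_cast Nat.cast_dvd_cast hmn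
      · rw [← Nat.cast_mul, ZMod.natCast_eq_zero_iff, PNat.mul_coe]
        exact mul_dvd_mul_left _ hpn
      · obtain ⟨k, hk⟩ := exists_int_proj_eq (n := n * p) ⟨p, PNat.mul_coe n p⟩
          (mem_congruence.1 hn i j)
        refine ⟨(k : ZMod ((n * p : ℕ+) : ℕ)), ?_⟩
        rw [Int.cast_mul, Int.cast_natCast] at hk
        rw [← hk]
        change proj (n * p) (A.val i j) - (1 : Matrix _ _ _) i j = _
        rw [Matrix.sub_apply, map_sub, one_apply, one_apply, apply_ite (proj (n * p)), map_one,
          map_zero]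
    obtain ⟨E, hE, hEA⟩ := elementary_le_map (proj (n * p)) (proj_surjective _)
      (by rw [map_natCast]) h1
    exact ⟨E, hE, by rw [congruence, MonoidHom.mem_ker, map_mul, map_inv, hEA, inv_mul_cancel]⟩
  · have : Fact (p : ℕ).Prime := ⟨hp⟩
    have hcop : Nat.Coprime n p := ((Nat.Prime.coprime_iff_not_dvd hp).2 hpn).symm
    -- As `n` is a unit modulo `p`, every generator over `𝔽_p` lifts to one of level `n`.
    obtain ⟨E, hE, hEA⟩ := elementary_le_map (m := ((n : ℕ) : ZHat)) (proj p) (proj_surjective _)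
      (by
        rw [map_natCast]
        exact ((ZMod.isUnit_iff_coprime n p).2 hcop).dvd)
      (mem_elementary_of_field (map_mem_map_Sp (proj p) hA))
    refine ⟨E, elementary_mono (Nat.cast_dvd_cast ((dvd_mul_right _ _).trans hmn)) hE, ?_⟩
    have h1 : E⁻¹ * A ∈ congruence g p := by
      rw [congruence, MonoidHom.mem_ker, map_mul, map_inv, hEA, inv_mul_cancel]
    have h2 : E⁻¹ * A ∈ congruence g n := mul_mem (inv_mem (elementary_le_congruence n hE)) hn
    exact mem_congruence.2 fun i j =>
      proj_mul_eq_zero hcop (mem_congruence.1 h2 i j) (mem_congruence.1 h1 i j)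

/-- The elementary subgroup of level `m` is dense in the group of symplectic matrices congruent to
`1` modulo `m²`. -/
theorem exists_elementary_mul {m : ℕ+} {A : GL (Fin g ⊕ Fin g) ZHat}
    (hA : A ∈ (Sp g ZHat).map (GSp g ZHat).subtype) (hm : A ∈ congruence g (m * m)) (k : ℕ+) :
    ∃ E ∈ elementary g ((m : ℕ) : ZHat), E⁻¹ * A ∈ congruence g (m * m * k) := by
  obtain ⟨n, hk⟩ : ∃ n : ℕ, (k : ℕ) = n := ⟨_, rfl⟩
  induction n using induction_on_primes generalizing k with
  | zero => exact absurd hk k.ne_zero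
  | one =>
    obtain rfl : k = 1 := PNat.eq hk
    exact ⟨1, one_mem _, by rwa [inv_one, one_mul, mul_one]⟩
  | prime_mul p a hp ih =>
    have ha : 0 < a := Nat.pos_of_ne_zero fun h => k.ne_zero (by rw [hk, h, mul_zero])
    obtain ⟨q, rfl⟩ : ∃ q : ℕ+, (q : ℕ) = p := ⟨⟨p, hp.pos⟩, rfl⟩
    obtain ⟨b, rfl⟩ : ∃ b : ℕ+, (b : ℕ) = a := ⟨⟨a, ha⟩, rfl⟩
    obtain rfl : k = q * b := PNat.eq (by rw [hk, PNat.mul_coe])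
    obtain ⟨E, hE, hEA⟩ := ih b rfl
    have hd : ((m : ℕ) * m) ∣ ((m * m * b : ℕ+) : ℕ) := ⟨b, by rw [PNat.mul_coe, PNat.mul_coe]⟩
    obtain ⟨E', hE', hEA'⟩ := exists_elementary_mul_prime hd hp
      (mul_mem (inv_mem (elementary_le_map_Sp _ hE)) hA) hEA
    refine ⟨E * E', mul_mem hE hE', ?_⟩
    rwa [mul_comm q, ← mul_assoc (m * m), _root_.mul_inv_rev, mul_assoc E'⁻¹]

end ZHat

open Filter Topology

/-! ### Congruence subgroups as neighbourhoods of 1 -/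

section Topology

variable {g : ℕ}

theorem tendsto_nhds_of_eventually_proj {α : Type*} {l : Filter α} {f : α → ZHat} {x : ZHat}
    (h : ∀ n, ∀ᶠ a in l, proj n (f a) = proj n x) : Tendsto f l (𝓝 x) :=
  tendsto_subtype_rng.2 (tendsto_pi_nhds.2 fun n => tendsto_nhds_of_eventually_eq (h n))

theorem tendsto_nhds_one_of_eventually_congruence {α : Type*} {l : Filter α}
    {f : α → GL (Fin g ⊕ Fin g) ZHat} (h : ∀ n, ∀ᶠ a in l, f a ∈ congruence g n) :
    Tendsto f l (𝓝 1) := by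
  have key : ∀ {f : α → GL (Fin g ⊕ Fin g) ZHat}, (∀ n, ∀ᶠ a in l, f a ∈ congruence g n) →
      Tendsto (fun a => (f a).val) l (𝓝 (1 : Matrix (Fin g ⊕ Fin g) (Fin g ⊕ Fin g) ZHat)) := by
    intro f h
    refine tendsto_pi_nhds.2 fun i => tendsto_pi_nhds.2 fun j =>
      tendsto_nhds_of_eventually_proj fun n => ?_
    filter_upwards [h n] with a ha
    have := mem_congruence.1 ha i j
    rwa [Matrix.sub_apply, map_sub, sub_eq_zero] at this
  -- Convergence of units means convergence of the matrices and of their inverses; congruence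
  -- subgroups are stable under inversion.
  rw [Units.isInducing_embedProduct.nhds_eq_comap, tendsto_comap_iff, map_one]
  refine (key h).prodMk_nhds ((MulOpposite.continuous_op.tendsto 1).comp
    (key (f := fun a => (f a)⁻¹) fun n => ?_))
  filter_upwards [h n] with a ha using inv_mem ha

/-- The filter generated by the congruence subgroups converges to 1. They are directed because level
`a * b` refines levels `a` and `b`. -/
theorem exists_congruence_subset {V : Set (GSp g ZHat)} (hV : V ∈ 𝓝 1) :
    ∃ n, ∀ A : GSp g ZHat, A.val ∈ congruence g n → A ∈ V := by
  set l : Filter (GSp g ZHat) := ⨅ n, 𝓟 {A | A.val ∈ congruence g n}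
  have h : Tendsto (fun A : GSp g ZHat => A) l (𝓝 1) :=
    tendsto_subtype_rng.2 (tendsto_nhds_one_of_eventually_congruence fun n =>
      mem_iInf_of_mem n (mem_principal_self _))
  have hdir : Directed (· ≥ ·) fun n => 𝓟 {A : GSp g ZHat | A.val ∈ congruence g n} :=
    fun a b => ⟨a * b, principal_mono.2 fun A hA => congruence_le ⟨b, PNat.mul_coe a b⟩ hA,
      principal_mono.2 fun A hA => congruence_le ⟨a, by rw [PNat.mul_coe, mul_comm]⟩ hA⟩
  obtain ⟨n, hn⟩ := (mem_iInf_of_directed hdir _).1 (h hV)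
  exact ⟨n, fun A hA => hn hA⟩

theorem isOpen_congruence (n : ℕ+) :
    IsOpen (congruence g n : Set (GL (Fin g ⊕ Fin g) ZHat)) := by
  have hproj : Continuous (proj n) := (continuous_apply n).comp continuous_subtype_val
  have : (congruence g n : Set (GL (Fin g ⊕ Fin g) ZHat)) =
      ⋂ i, ⋂ j, (fun A : GL (Fin g ⊕ Fin g) ZHat => proj n ((A.val - 1) i j)) ⁻¹' {0} := by
    ext A
    simp only [SetLike.mem_coe, mem_congruence, Set.mem_iInter, Set.mem_preimage,
      Set.mem_singleton_iff]
  rw [this]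
  refine isOpen_iInter_of_finite fun i => isOpen_iInter_of_finite fun j => ?_
  refine (isOpen_discrete _).preimage (hproj.comp ?_)
  exact (Units.continuous_val.sub continuous_const).matrix_elem i j

theorem isClosed_Sp : IsClosed (Sp g ZHat : Set (GSp g ZHat)) := by
  have h : Continuous fun S : GSp g ZHat => S.val.val :=
    Units.continuous_val.comp continuous_subtype_val
  exact isClosed_eq ((h.matrix_transpose.matrix_mul continuous_const).matrix_mul h)
    continuous_const

end Topology

/-! ### Commutators of an open subgroup -/

theorem commutator_le_Sp {g : ℕ} {R : Type*} [CommRing R] (H K : Subgroup (GSp g R)) :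
    ⁅H, K⁆ ≤ Sp g R := by
  refine Subgroup.commutator_le.2 fun A _ B _ => ?_
  obtain ⟨m, hm⟩ := A.2
  obtain ⟨n, hn⟩ := B.2
  have key : ∀ {A B : GSp g R} {m n : Rˣ},
      A.val.valᵀ * Omega g R * A.val.val = (m : R) • Omega g R →
      B.val.valᵀ * Omega g R * B.val.val = (n : R) • Omega g R →
      (A * B).val.valᵀ * Omega g R * (A * B).val.val = ((m : R) * n) • Omega g R := by
    intro A B m n hA hB
    calc (A * B).val.valᵀ * Omega g R * (A * B).val.val
        = B.val.valᵀ * (A.val.valᵀ * Omega g R * A.val.val) * B.val.val := by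
          simp only [Subgroup.coe_mul, Units.val_mul, transpose_mul, Matrix.mul_assoc]
      _ = ((m : R) * n) • Omega g R := by
          rw [hA, Matrix.mul_smul, Matrix.smul_mul, hB, smul_smul]
  have h1 := key hm hn
  have h2 := key hn hm
  -- `A B` and `B A` transform `Ω` in the same way, so their quotient, the commutator, fixes it.
  rw [mul_comm (n : R), ← h1] at h2
  have e1 : (B * A).val.val * ((B * A)⁻¹).val.val = 1 := Units.mul_inv (B * A).val
  have e2 : ((B * A)⁻¹).val.valᵀ * (B * A).val.valᵀ = 1 := by
    rw [← transpose_mul, e1, transpose_one]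
  obtain ⟨X, e3, hX⟩ : ∃ X, X = A * B * (B * A)⁻¹ ∧ A * B * A⁻¹ * B⁻¹ = X := ⟨_, rfl, by group⟩
  rw [commutatorElement_def, hX]
  change X.val.valᵀ * Omega g R * X.val.val = Omega g R
  calc X.val.valᵀ * Omega g R * X.val.val
      = ((B * A)⁻¹).val.valᵀ * ((A * B).val.valᵀ * Omega g R * (A * B).val.val) *
          ((B * A)⁻¹).val.val := by
        rw [e3]
        simp only [Subgroup.coe_mul (GSp g R) (A * B), Units.val_mul (A * B).val, transpose_mul,
          Matrix.mul_assoc]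
    _ = (((B * A)⁻¹).val.valᵀ * (B * A).val.valᵀ) * Omega g R *
          ((B * A).val.val * ((B * A)⁻¹).val.val) := by
        rw [← h2]
        simp only [Matrix.mul_assoc]
    _ = Omega g R := by rw [e1, e2, Matrix.one_mul, Matrix.mul_one]

theorem levi_elementaryGL_mem_congruence {g : ℕ} {i j : Fin g} (hij : i ≠ j) (n : ℕ+) :
    levi (elementaryGL i j hij ((n : ℕ) : ZHat)) ∈ congruence g n := by
  have : GeneralLinearGroup.map (proj n) (elementaryGL i j hij ((n : ℕ) : ZHat)) = 1 := by
    ext1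
    change (1 + single i j ((n : ℕ) : ZHat)).map (proj n) = 1
    rw [Matrix.map_add _ (map_add _), map_single, map_natCast, ZMod.natCast_self, single_zero,
      add_zero, Matrix.map_one _ (map_zero _) (map_one _)]
  rw [congruence, MonoidHom.mem_ker, map_levi, this, map_one]

/-- The commutator subgroup of an open subgroup of `GSp_{2g}(Ẑ)`, with `g ≥ 2`, is dense in a
principal congruence subgroup of `Sp_{2g}(Ẑ)`. -/
theorem exists_congruence_le_closure_commutator {g : ℕ} (hg : 2 ≤ g) {H : Subgroup (GSp g ZHat)}
    (hH : IsOpen (H : Set (GSp g ZHat))) :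
    ∃ n, ∀ A ∈ Sp g ZHat, A.val ∈ congruence g n → A ∈ (⁅H, H⁆).topologicalClosure := by
  obtain ⟨N, hN⟩ := exists_congruence_subset (hH.mem_nhds (one_mem H))
  have hmem : ∀ A ∈ (Sp g ZHat).map (GSp g ZHat).subtype, A ∈ congruence g N →
      A ∈ H.map (GSp g ZHat).subtype := by
    rintro _ ⟨A, -, rfl⟩ hA
    exact ⟨A, hN A hA, rfl⟩
  have hE : elementary g (((2 * (N * N) : ℕ+) : ℕ) : ZHat) ≤ (⁅H, H⁆).map (GSp g ZHat).subtype := by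
    rw [Subgroup.map_commutator]
    have := elementary_le_commutator (N := ((N : ℕ) : ZHat)) hg
      (K := H.map (GSp g ZHat).subtype)
      (fun A hA => hmem A (elementary_le_map_Sp _ hA) (elementary_le_congruence N hA))
      (fun i j hij => hmem _ (levi_mem_map_Sp _) (levi_elementaryGL_mem_congruence hij N))
    simpa using this
  -- The square of the level `2N²` reached by commutators, as the density statement requires.
  refine ⟨2 * (N * N) * (2 * (N * N)), fun A hA hAn => ?_⟩
  change A ∈ closure _
  rw [mem_closure_iff_nhds]
  intro V hV
  -- At `E⁻¹ A` this map takes the value `E`, so a good enough elementary approximation `E` of `A`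
  -- lies in `V`.
  have hV' : (fun B => A * B⁻¹) ⁻¹' V ∈ 𝓝 (1 : GSp g ZHat) := by
    refine ContinuousAt.preimage_mem_nhds (by fun_prop) ?_
    simpa using hV
  obtain ⟨k, hk⟩ := exists_congruence_subset hV'
  obtain ⟨E, hE', hEA⟩ := exists_elementary_mul ⟨A, hA, rfl⟩ hAn k
  obtain ⟨B, hB, rfl⟩ := hE hE'
  refine ⟨B, ?_, hB⟩
  have := hk (B⁻¹ * A) (congruence_le ⟨_, (PNat.mul_coe _ k).trans (mul_comm _ _)⟩ hEA)
  simpa using this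

end AdelicSymplectic

theorem proposition2p7 (g : ℕ) (hg : 2 ≤ g)
    (H : Subgroup (AdelicSymplectic.GSp g AdelicSymplectic.ZHat))
    (hH : IsOpen (H : Set (AdelicSymplectic.GSp g AdelicSymplectic.ZHat))) :
    (⁅H, H⁆).topologicalClosure ≤ AdelicSymplectic.Sp g AdelicSymplectic.ZHat ∧
      IsOpen (((⁅H, H⁆).topologicalClosure.subgroupOf
          (AdelicSymplectic.Sp g AdelicSymplectic.ZHat) :
            Subgroup (AdelicSymplectic.Sp g AdelicSymplectic.ZHat)) :
        Set (AdelicSymplectic.Sp g AdelicSymplectic.ZHat)) := by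
  refine ⟨Subgroup.topologicalClosure_minimal _ (AdelicSymplectic.commutator_le_Sp H H)
    AdelicSymplectic.isClosed_Sp, ?_⟩
  obtain ⟨n, hn⟩ := AdelicSymplectic.exists_congruence_le_closure_commutator hg hH
  refine Subgroup.isOpen_of_mem_nhds _ (g := 1) (Filter.mem_of_superset
    (((AdelicSymplectic.isOpen_congruence n).preimage
      (continuous_subtype_val.comp continuous_subtype_val)).mem_nhds ?_) fun A hA => ?_)
  · exact one_mem (AdelicSymplectic.congruence g n)
  · exact hn A.val A.2 hA
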